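/- **Conventions.** Let $\mathscr A$ be an abelian category with enough projectives and enough injectives satisfying AB4 and AB4$^*$ (it has arbitrary direct sums and products, and these are exact). All subcategories are full and closed under isomorphisms; $\mathcal P(\mathscr A)$ and $\mathcal I(\mathscr A)$ are the subcategories of projective and of injective objects. For a subcategory $\mathscr X$ and an object $M$, $\mathscr X\text{-}\mathrm{pd}\,M\in\mathbb N\cup\{\infty\}$ is the infimum of the $m\ge 0$ for which there is an exact sequence $0\to X_m\to\cdots\to X_0\to M\to 0$ with all $X_i\in\mathscr X$, and $\mathrm{id}\,M$ is the infimum of the $m\ge 0$ for which there is an exact sequence $0\to M\to I^0\to\cdots\to I^m\to 0$ with all $I^i$ injective (with $\inf\emptyset=\infty$). For a subcategory $\mathscr Y$, $\mathscr X\text{-}\mathrm{pd}\,\mathscr Y$ and $\mathrm{id}\,\mathscr Y$ are the suprema of these dimensions over $\mathscr Y$; $\mathscr X\text{-}\mathrm{pd}^{\le n}$ and $\mathrm{id}^{\le n}$ are the subcategories of objects with $\mathscr X$-projective, respectively injective, dimension at most $n$. Put ${}^{\perp}\mathscr D=\{M\mid \mathrm{Ext}^{i}_{\mathscr A}(M,D)=0\text{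 for all } i\ge 1,\ D\in\mathscr D\}$, and let $r\mathcal G(\mathscr C,\mathscr D)$ be the subcategory of those $M\in{}^{\perp}\mathscr D$ for which there is an exact sequence $0\to M\to C^0\to C^1\to\cdots$ with all $C^i\in\mathscr C$ that stays exact under $\mathrm{Hom}_{\mathscr A}(-,D)$ for every $D\in\mathscr D$. A subcategory is *closed under kernels of epimorphisms* if for every short exact sequence $0\to X'\to X\to X''\to 0$ with $X,X''$ in it, also $X'$ is in it; it is *resolving* if it contains $\mathcal P(\mathscr A)$ and is closed under extensions and kernels of epimorphisms; it is *precovering* if every object $M$ admits a morphism $f:X\to M$ with $X$ in it such that every morphism to $M$ from an object of it factors through $f$. **Theorem 3.11.** Let $\mathscr C$ and $\mathscr D$ be subcategories of $\mathscr A$, where $\mathscr C$ is additive (closed under finite direct sums, including the zero object) and closed under direct summands. Assume that $\mathscr C\subseteq\mathscr D\cap{}^{\perp}\mathscr D$ and $\mathcal P(\mathscr A)\subseteq r\mathcal G(\mathscr C,\mathscr D)$, and let $n\ge 0$. Consider the following conditions. 1. $\mathscr A$ is right $n$-$(\mathscr C,\mathscr D)$-Gorenstein, that is, $\mathscr C\text{-}\mathrm{pd}\,\mathcal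 I(\mathscr A)\le n$ and $\mathrm{id}\,\mathscr D\le n$. 2. $r\mathcal G(\mathscr C,\mathscr D)\text{-}\mathrm{pd}\,M\le n$ for every $M\in\mathscr A$. 3. $r\mathcal G(\mathscr C,\mathscr D)\text{-}\mathrm{pd}\,\mathcal I(\mathscr A)\le n$ and $\mathrm{id}\,\mathscr D\le n$. 4. $\mathscr D\text{-}\mathrm{pd}^{\le n}=\mathrm{id}^{\le n}=\mathscr C\text{-}\mathrm{pd}^{\le n}$. 5. $\mathscr D\text{-}\mathrm{pd}^{\le n}\subseteq\mathrm{id}^{\le n}\subseteq r\mathcal G(\mathscr C,\mathscr D)\text{-}\mathrm{pd}^{\le n}$. Then $(4)\Rightarrow(1)\Leftrightarrow(2)\Leftrightarrow(3)\Leftarrow(5)$. Moreover: (i) if $\mathscr C$ is closed under kernels of epimorphisms, then (1)–(4) are equivalent; (ii) if $r\mathcal G(\mathscr C,\mathscr D)$ is precovering and resolving, then (1)–(3) and (5) are equivalent. -/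

import Mathlib

open CategoryTheory CategoryTheory.Limits

universe w v u

/-!
Relative homological algebra in an abelian category.  Full subcategories are given by
properties of objects (`ObjectProperty A`).
-/

namespace RelGor

section Sequences

variable {A : Type u} [Category.{v} A] [Abelian A]

/-- The sequence `⋯ ⟶ X 2 ⟶ X 1 ⟶ X 0 ⟶ M ⟶ 0`, with differentials `d` and augmentation `ε`,
is exact. -/
structure IsExactResolution (M : A) (X : ℕ → A) (d : ∀ i, X (i + 1) ⟶ X i) (ε : X 0 ⟶ M) :
    Prop where
  epi : Epi ε
  zero_aug : d 0 ≫ ε = 0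
  exact_aug : (ShortComplex.mk (d 0) ε zero_aug).Exact
  zero : ∀ i, d (i + 1) ≫ d i = 0
  exact : ∀ i, (ShortComplex.mk (d (i + 1)) (d i) (zero i)).Exact

/-- The sequence `0 ⟶ M ⟶ X 0 ⟶ X 1 ⟶ X 2 ⟶ ⋯`, with coaugmentation `η` and
differentials `d`, is exact. -/
structure IsExactCoresolution (M : A) (X : ℕ → A) (η : M ⟶ X 0) (d : ∀ i, X i ⟶ X (i + 1)) :
    Prop where
  mono : Mono η
  zero_aug : η ≫ d 0 = 0
  exact_aug : (ShortComplex.mk η (d 0) zero_aug).Exact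
  zero : ∀ i, d i ≫ d (i + 1) = 0
  exact : ∀ i, (ShortComplex.mk (d i) (d (i + 1)) (zero i)).Exact

/-- The sequence `⋯ ⟶ Hom (X 1) Y ⟶ Hom (X 0) Y ⟶ Hom M Y ⟶ 0` obtained by applying `Hom(-, Y)`
to `0 ⟶ M ⟶ X 0 ⟶ X 1 ⟶ ⋯` is exact for all `Y` in `P`. -/
structure IsHomExact (P : ObjectProperty A) (M : A) (X : ℕ → A) (η : M ⟶ X 0)
    (d : ∀ i, X i ⟶ X (i + 1)) : Prop where
  surjective : ∀ Y, P Y → Function.Surjective (fun g : X 0 ⟶ Y => η ≫ g)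
  exact_aug : ∀ Y, P Y → Function.Exact (fun g : X 1 ⟶ Y => d 0 ≫ g) (fun g : X 0 ⟶ Y => η ≫ g)
  exact : ∀ i Y, P Y →
    Function.Exact (fun g : X (i + 2) ⟶ Y => d (i + 1) ≫ g) (fun g : X (i + 1) ⟶ Y => d i ≫ g)

/-- There is an exact sequence `0 ⟶ X n ⟶ ⋯ ⟶ X 1 ⟶ X 0 ⟶ M ⟶ 0` with all `X i` in `P`. -/
def HasResolutionOfLength (P : ObjectProperty A) (M : A) (n : ℕ) : Prop :=
  ∃ (X : ℕ → A) (d : ∀ i, X (i + 1) ⟶ X i) (ε : X 0 ⟶ M), IsExactResolution M X d ε ∧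
    (∀ i, i ≤ n → P (X i)) ∧ ∀ i, n < i → IsZero (X i)

/-- There is an exact sequence `0 ⟶ M ⟶ X 0 ⟶ X 1 ⟶ ⋯ ⟶ X n ⟶ 0` with all `X i` in `P`. -/
def HasCoresolutionOfLength (P : ObjectProperty A) (M : A) (n : ℕ) : Prop :=
  ∃ (X : ℕ → A) (η : M ⟶ X 0) (d : ∀ i, X i ⟶ X (i + 1)), IsExactCoresolution M X η d ∧
    (∀ i, i ≤ n → P (X i)) ∧ ∀ i, n < i → IsZero (X i)

end Sequences

section Dimensions

variable {A : Type u} [Category.{v} A] [Abelian A]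

/-- The `P`-projective dimension of `M`; it is `⊤` if there is no finite `P`-resolution. -/
noncomputable def relPd (P : ObjectProperty A) (M : A) : ℕ∞ :=
  ⨅ (n : ℕ) (_ : HasResolutionOfLength P M n), (n : ℕ∞)

/-- The `P`-injective dimension of `M`; it is `⊤` if there is no finite `P`-coresolution. -/
noncomputable def relId (P : ObjectProperty A) (M : A) : ℕ∞ :=
  ⨅ (n : ℕ) (_ : HasCoresolutionOfLength P M n), (n : ℕ∞)

/-- The injective dimension of `M`. -/
noncomputable def injDim (M : A) : ℕ∞ := relId (isInjective A) M

/-- The supremum of the `P`-projective dimensions of the objects in `Q`. -/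
noncomputable def relPdSup (P Q : ObjectProperty A) : ℕ∞ :=
  ⨆ (M : A) (_ : Q M), relPd P M

/-- The supremum of the injective dimensions of the objects in `Q`. -/
noncomputable def injDimSup (Q : ObjectProperty A) : ℕ∞ :=
  ⨆ (M : A) (_ : Q M), injDim M

/-- The subcategory of objects with `P`-projective dimension at most `n`. -/
def relPdLE (P : ObjectProperty A) (n : ℕ) : ObjectProperty A :=
  fun M => relPd P M ≤ n

/-- The subcategory of objects with injective dimension at most `n`. -/
def injDimLE (A : Type u) [Category.{v} A] [Abelian A] (n : ℕ) : ObjectProperty A :=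
  fun M => injDim M ≤ n

end Dimensions

section Subcategories

variable {A : Type u} [Category.{v} A] [Abelian A]

/-- Closure under kernels of epimorphisms (between objects of the subcategory). -/
def ClosedUnderKernelsOfEpis (P : ObjectProperty A) : Prop :=
  ∀ S : ShortComplex A, S.ShortExact → P S.X₂ → P S.X₃ → P S.X₁

/-- Resolving subcategories. -/
def IsResolving (P : ObjectProperty A) : Prop :=
  isProjective A ≤ P ∧ P.IsClosedUnderExtensions ∧ ClosedUnderKernelsOfEpis P

/-- Precovering subcategories: every object `M` has a morphism from some `X` in `P` through
which all morphisms to `M` from objects of `P` factor. -/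
def IsPrecovering (P : ObjectProperty A) : Prop :=
  ∀ M : A, ∃ (X : A) (f : X ⟶ M), P X ∧
    ∀ X' : A, P X' → Function.Surjective (fun g : X' ⟶ X => g ≫ f)

/-- The objects `M` with `Extⁱ(M, Y) = 0` for all `i ≥ 1` and all `Y` in `P`. -/
def leftPerp [HasExt.{w} A] (P : ObjectProperty A) : ObjectProperty A :=
  fun M => ∀ Y, P Y → ∀ i : ℕ, 1 ≤ i → Subsingleton (Abelian.Ext M Y i)

/-- The objects `M` having a `Hom(-, Q)`-exact exact sequence `0 ⟶ M ⟶ X 0 ⟶ X 1 ⟶ ⋯` with all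
`X i` in `P`. -/
def cores (Q P : ObjectProperty A) : ObjectProperty A :=
  fun M => ∃ (X : ℕ → A) (η : M ⟶ X 0) (d : ∀ i, X i ⟶ X (i + 1)),
    IsExactCoresolution M X η d ∧ IsHomExact Q M X η d ∧ ∀ i, P (X i)

/-- The right Gorenstein subcategory relative to `C` and `D`. -/
def rG [HasExt.{w} A] (C D : ObjectProperty A) : ObjectProperty A :=
  leftPerp D ⊓ cores D C

/-- The ambient category is right `n`-`(C, D)`-Gorenstein. -/
def IsRightGorenstein (C D : ObjectProperty A) (n : ℕ) : Prop :=
  relPdSup C (isInjective A) ≤ n ∧ injDimSup D ≤ n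

end Subcategories

end RelGor

/-! Since `C` lies in `leftPerp D`, `rG C D` is the largest class inside `leftPerp D` whose members
embed in an object of `C` with cokernel again in the class (`rG_of_coinduction`,
`exists_hasSES_of_rG`). Membership thus reduces to choosing a class and making one embedding. This
yields closure under extensions and kernels of epimorphisms, and stability: embeddings into `rG C D`
instead of `C` already suffice (`rG_of_coinduction_rG`).

Suppose injectives have `rG`-dimension at most `n` and objects of `D` have injective dimension at
most `n`. The class of all `n`-th syzygies lies in `leftPerp D` by dimension shifting. Embedding `M`
in an injective `I` and applying the horseshoe lemma embeds a syzygy of `M` in a syzygy of `I`,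
which is in `rG C D` by Schanuel's argument, and the cokernel is again an `n`-th syzygy. By
stability all `n`-th syzygies lie in `rG C D`, so every object has `rG`-dimension at most `n`
(`pdLE_rG_of_injective`). Conversely, such a uniform bound kills `Ext` into `D` above degree `n`.

To pass from `rG`-dimension to `C`-dimension for an injective `I`, embed it in some `L` of
`C`-dimension at most `n` with cokernel in `rG C D`; a splitting then gives the bound, as `C` is
closed under summands (`pdLE_of_injective_of_pdLE_rG`).

The conditions on subcategories are tested on injectives and on objects of `D`. If `C` is closed
under kernels of epimorphisms, so is the class of `C`-dimension at most `n`, and the bound spreads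
from injectives to all objects of finite injective dimension. -/

namespace RelGor

open scoped ZeroObject

/-! ### Splicing, pushout and pullback of short exact sequences. -/

section ShortExactSequences

variable {A : Type u} [Category.{v} A] [Abelian A]

/-- `0 ⟶ X ⟶ Y ⟶ Z ⟶ 0` is exact. -/
def SES {X Y Z : A} (f : X ⟶ Y) (g : Y ⟶ Z) : Prop :=
  ∃ w : f ≫ g = 0, (ShortComplex.mk f g w).ShortExact

/-- There is a short exact sequence `0 ⟶ X ⟶ Y ⟶ Z ⟶ 0`. -/
def HasSES (X Y Z : A) : Prop :=
  ∃ (f : X ⟶ Y) (g : Y ⟶ Z), SES f g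

namespace SES

variable {X Y Z : A} {f : X ⟶ Y} {g : Y ⟶ Z}

lemma zero (h : SES f g) : f ≫ g = 0 := h.1

lemma mono (h : SES f g) : Mono f := h.2.mono_f

lemma epi (h : SES f g) : Epi g := h.2.epi_g

lemma exact (h : SES f g) : (ShortComplex.mk f g h.zero).Exact := h.2.exact

lemma exists_desc (h : SES f g) {T : A} (k : Y ⟶ T) (hk : f ≫ k = 0) : ∃ l : Z ⟶ T, g ≫ l = k :=
  have := h.epi
  ⟨h.exact.desc k hk, h.exact.g_desc k hk⟩

lemma exists_lift (h : SES f g) {T : A} (k : T ⟶ Y) (hk : k ≫ g = 0) : ∃ l : T ⟶ X, l ≫ f = k :=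
  have := h.mono
  ⟨h.exact.lift k hk, h.exact.lift_f k hk⟩

/-- Existence of factorizations is enough: uniqueness follows from `g` being epi, so `g` is a
cokernel of `f`. -/
lemma of_desc (hf : Mono f) (hg : Epi g) (w : f ≫ g = 0)
    (H : ∀ {T : A} (k : Y ⟶ T), f ≫ k = 0 → ∃ l : Z ⟶ T, g ≫ l = k) : SES f g := by
  refine ⟨w, ShortComplex.ShortExact.mk' ?_ hf hg⟩
  refine ShortComplex.exact_of_g_is_cokernel _ ?_
  refine CokernelCofork.IsColimit.ofπ' _ _ fun k hk => ?_
  exact ⟨(H k hk).choose, (H k hk).choose_spec⟩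

lemma cokernel (f : X ⟶ Y) [Mono f] : SES f (cokernel.π f) :=
  of_desc inferInstance inferInstance (cokernel.condition f)
    fun k hk => ⟨cokernel.desc f k hk, cokernel.π_desc f k hk⟩

lemma kernel (g : Y ⟶ Z) [Epi g] : SES (kernel.ι g) g :=
  ⟨kernel.condition g, ShortComplex.ShortExact.mk' (ShortComplex.exact_kernel g)
    inferInstance inferInstance⟩

lemma op (h : SES f g) : SES g.op f.op :=
  ⟨by rw [← op_comp, h.zero, op_zero], h.2.op⟩

lemma unop {X Y Z : Aᵒᵖ} {f : X ⟶ Y} {g : Y ⟶ Z} (h : SES f g) : SES g.unop f.unop :=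
  ⟨by rw [← unop_comp, h.zero, unop_zero], h.2.unop⟩

lemma of_iso {X' Y' Z' : A} (h : SES f g) (a : X ≅ X') (b : Y ≅ Y') (c : Z ≅ Z') :
    SES (a.inv ≫ f ≫ b.hom) (b.inv ≫ g ≫ c.hom) := by
  refine ⟨by simp [reassoc_of% h.zero], ShortComplex.shortExact_of_iso ?_ h.2⟩
  exact ShortComplex.isoMk a b c

lemma of_isPushout (h : SES f g) {X' Y' : A} {a : X ⟶ X'} {i : Y ⟶ Y'} {j : X' ⟶ Y'}
    (sq : IsPushout f a i j) : ∃ b : Y' ⟶ Z, SES j b := by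
  have := h.mono
  have := h.epi
  have hi : i ≫ sq.desc g 0 (by simp [h.zero]) = g := sq.inl_desc _ _ _
  have hj : j ≫ sq.desc g 0 (by simp [h.zero]) = 0 := sq.inr_desc _ _ _
  refine ⟨sq.desc g 0 (by simp [h.zero]), of_desc ?_ ?_ hj ?_⟩
  · exact Abelian.mono_inr_of_isColimit _ _ sq.isColimit
  · exact epi_of_epi_fac hi
  · intro T k hk
    obtain ⟨l, hl⟩ := h.exists_desc (i ≫ k) (by rw [reassoc_of% sq.w, hk, comp_zero])
    refine ⟨l, sq.hom_ext ?_ ?_⟩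
    · rw [reassoc_of% hi, hl]
    · rw [reassoc_of% hj, zero_comp, hk]

/-- The third isomorphism theorem, `0 ⟶ Y/X ⟶ C/X ⟶ C/Y ⟶ 0`. -/
lemma comp_mono {C W : A} {h : Y ⟶ C} {p : C ⟶ W} (hfg : SES f g) (hhp : SES h p) :
    ∃ (k : Z ⟶ Limits.cokernel (f ≫ h)) (r : Limits.cokernel (f ≫ h) ⟶ W), SES k r := by
  have := hfg.mono
  have := hhp.mono
  have := hfg.epi
  have := hhp.epi
  obtain ⟨k, hk⟩ := hfg.exists_desc (h ≫ cokernel.π (f ≫ h)) (by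
    rw [← Category.assoc, cokernel.condition])
  have hr : cokernel.π (f ≫ h) ≫ cokernel.desc (f ≫ h) p (by simp [hhp.zero]) = p :=
    cokernel.π_desc _ _ _
  refine ⟨k, cokernel.desc (f ≫ h) p (by simp [hhp.zero]), of_desc ?_ ?_ ?_ ?_⟩
  -- A generalized element of `Z` killed by `k` lifts to `y` in `Y`; then `h y` comes from `X`, so
  -- `y` does too and its image in `Z` is zero.
  · refine Preadditive.mono_of_cancel_zero _ fun {T} z hz => ?_
    obtain ⟨T', π, _, y, hy⟩ := surjective_up_to_refinements_of_epi g z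
    obtain ⟨x, hx⟩ := (SES.cokernel (f ≫ h)).exists_lift (y ≫ h) (by
      rw [Category.assoc, ← hk, ← Category.assoc, ← hy, Category.assoc, hz, comp_zero])
    have hxy : x ≫ f = y := by
      rw [← cancel_mono h, Category.assoc, hx]
    rw [← cancel_epi π, hy, ← hxy, Category.assoc, hfg.zero, comp_zero, comp_zero]
  · exact epi_of_epi_fac hr
  · rw [← cancel_epi g, reassoc_of% hk, hr, hhp.zero, comp_zero]
  · intro T t ht
    obtain ⟨l, hl⟩ := hhp.exists_desc (cokernel.π (f ≫ h) ≫ t) (by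
      rw [← Category.assoc, ← hk, Category.assoc, ht, comp_zero])
    refine ⟨l, ?_⟩
    rw [← cancel_epi (cokernel.π (f ≫ h)), reassoc_of% hr, hl]

lemma exact_comp_epi_mono (h : SES f g) {S T : A} (e : S ⟶ X) [Epi e] (m : Z ⟶ T) [Mono m]
    (w : (e ≫ f) ≫ g ≫ m = 0) : (ShortComplex.mk (e ≫ f) (g ≫ m) w).Exact := by
  let S₁ := ShortComplex.mk (e ≫ f) g (by rw [Category.assoc, h.zero, comp_zero])
  let φ : S₁ ⟶ ShortComplex.mk f g h.zero :=
    { τ₁ := e, τ₂ := 𝟙 _, τ₃ := 𝟙 _ }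
  have : Epi φ.τ₁ := ‹_›
  have : IsIso φ.τ₂ := IsIso.id _
  have : Mono φ.τ₃ := by dsimp [φ]; infer_instance
  have h₁ : S₁.Exact := (ShortComplex.exact_iff_of_epi_of_isIso_of_mono φ).2 h.exact
  let ψ : S₁ ⟶ ShortComplex.mk (e ≫ f) (g ≫ m) w :=
    { τ₁ := 𝟙 _, τ₂ := 𝟙 _, τ₃ := m }
  have : Epi ψ.τ₁ := by dsimp [ψ]; infer_instance
  have : IsIso ψ.τ₂ := IsIso.id _
  have : Mono ψ.τ₃ := ‹_›
  exact (ShortComplex.exact_iff_of_epi_of_isIso_of_mono ψ).1 h₁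

end SES

namespace HasSES

lemma op {X Y Z : A} (h : HasSES X Y Z) :
    HasSES (Opposite.op Z) (Opposite.op Y) (Opposite.op X) := by
  obtain ⟨f, g, h⟩ := h
  exact ⟨_, _, h.op⟩

lemma unop {X Y Z : Aᵒᵖ} (h : HasSES X Y Z) : HasSES Z.unop Y.unop X.unop := by
  obtain ⟨f, g, h⟩ := h
  exact ⟨_, _, h.unop⟩

lemma of_iso {X Y Z X' Y' Z' : A} (h : HasSES X Y Z) (a : X ≅ X') (b : Y ≅ Y') (c : Z ≅ Z') :
    HasSES X' Y' Z' := by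
  obtain ⟨f, g, h⟩ := h
  exact ⟨_, _, h.of_iso a b c⟩

lemma biprod (X Y : A) : HasSES X (X ⊞ Y) Y :=
  ⟨biprod.inl, biprod.snd, by simp, (ShortComplex.Splitting.ofHasBinaryBiproduct X Y).shortExact⟩

lemma id_zero (X : A) : HasSES X X (0 : A) :=
  ⟨𝟙 X, 0, SES.of_desc inferInstance inferInstance (by simp) fun k hk =>
    ⟨0, by simpa using hk.symm⟩⟩

lemma zero_id (X : A) : HasSES (0 : A) X X :=
  ⟨0, 𝟙 X, SES.of_desc inferInstance inferInstance (by simp) fun k _ => ⟨k, by simp⟩⟩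

lemma pushout {X Y Z X' W : A} (h : HasSES X Y Z) (h' : HasSES X X' W) :
    ∃ Y' : A, HasSES X' Y' Z ∧ HasSES Y Y' W := by
  obtain ⟨f, g, h⟩ := h
  obtain ⟨a, b, h'⟩ := h'
  have sq := IsPushout.of_hasPushout f a
  obtain ⟨_, h₁⟩ := h.of_isPushout sq
  obtain ⟨_, h₂⟩ := h'.of_isPushout sq.flip
  exact ⟨_, ⟨_, _, h₁⟩, ⟨_, _, h₂⟩⟩

lemma comp_mono {X Y Z C W : A} (h : HasSES X Y Z) (h' : HasSES Y C W) :
    ∃ Q : A, HasSES X C Q ∧ HasSES Z Q W := by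
  obtain ⟨f, g, h⟩ := h
  obtain ⟨a, b, h'⟩ := h'
  have := h.mono
  have := h'.mono
  obtain ⟨_, _, h₁⟩ := h.comp_mono h'
  exact ⟨_, ⟨_, _, SES.cokernel (f ≫ a)⟩, ⟨_, _, h₁⟩⟩

lemma pullback {X Y Z Z' W : A} (h : HasSES X Y Z) (h' : HasSES W Z' Z) :
    ∃ Y' : A, HasSES X Y' Z' ∧ HasSES W Y' Y := by
  obtain ⟨Y', h₁, h₂⟩ := h.op.pushout h'.op
  exact ⟨_, h₁.unop, h₂.unop⟩

lemma comp_epi {X Y Z C W : A} (h : HasSES X Y Z) (h' : HasSES W C Y) :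
    ∃ Q : A, HasSES Q C Z ∧ HasSES W Q X := by
  obtain ⟨Y', h₁, h₂⟩ := h.op.comp_mono h'.op
  exact ⟨_, h₁.unop, h₂.unop⟩

lemma biprod_right {X Y Z : A} (h : HasSES X Y Z) (B : A) : HasSES (B ⊞ X) (B ⊞ Y) Z := by
  obtain ⟨f, g, h⟩ := h
  have := h.mono
  have := h.epi
  refine ⟨biprod.map (𝟙 B) f, biprod.snd ≫ g, SES.of_desc inferInstance inferInstance
    (by simp [h.zero]) fun k hk => ?_⟩
  have hl : biprod.inl ≫ k = 0 := by
    have := biprod.inl ≫= hk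
    simpa using this
  obtain ⟨l, hl'⟩ := h.exists_desc (biprod.inr ≫ k) (by
    have := biprod.inr ≫= hk
    simpa using this)
  refine ⟨l, ?_⟩
  apply biprod.hom_ext'
  · simp [hl]
  · simp [hl']

lemma biprod_left {X Y Z : A} (h : HasSES X Y Z) (B : A) : HasSES X (B ⊞ Y) (B ⊞ Z) := by
  obtain ⟨f, g, h⟩ := h
  have := h.mono
  have := h.epi
  refine ⟨f ≫ biprod.inr, biprod.map (𝟙 B) g, SES.of_desc inferInstance inferInstance
    (by simp [reassoc_of% h.zero]) fun k hk => ?_⟩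
  obtain ⟨l, hl'⟩ := h.exists_desc (biprod.inr ≫ k) (by simpa using hk)
  refine ⟨biprod.desc (biprod.inl ≫ k) l, ?_⟩
  apply biprod.hom_ext'
  · simp
  · simp [hl']

/-! ### Vanishing of `Ext` along short exact sequences, and splitting. -/

section Ext

variable [HasExt.{w} A] {X Y Z : A}

open Abelian

lemma subsingleton_ext_of_iso {M M' N N' : A} (a : M ≅ M') (b : N ≅ N') (i : ℕ)
    (h : Subsingleton (Ext.{w} M N i)) : Subsingleton (Ext.{w} M' N' i) := by
  refine subsingleton_of_forall_eq 0 fun x => ?_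
  have hx : (Ext.mk₀ a.inv).comp ((Ext.mk₀ a.hom).comp
      ((x.comp (Ext.mk₀ b.inv) (add_zero i)).comp (Ext.mk₀ b.hom) (add_zero i)) (zero_add i))
      (zero_add i) = x := by
    simp
  rw [← hx, ← Ext.comp_assoc_of_third_deg_zero, h.elim ((Ext.mk₀ a.hom).comp _ _) 0]
  simp

lemma ext_middle_right (h : HasSES X Y Z) (M : A) (i : ℕ) (h₁ : Subsingleton (Ext.{w} M X i))
    (h₃ : Subsingleton (Ext.{w} M Z i)) : Subsingleton (Ext.{w} M Y i) := by
  obtain ⟨f, g, w, h⟩ := h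
  refine subsingleton_of_forall_eq 0 fun x => ?_
  obtain ⟨y, rfl⟩ := Ext.covariant_sequence_exact₂ M h x (h₃.elim _ _)
  rw [h₁.elim y 0, Ext.zero_comp]

lemma ext_right_right (h : HasSES X Y Z) (M : A) (i : ℕ) (h₂ : Subsingleton (Ext.{w} M Y i))
    (h₁ : Subsingleton (Ext.{w} M X (i + 1))) : Subsingleton (Ext.{w} M Z i) := by
  obtain ⟨f, g, w, h⟩ := h
  refine subsingleton_of_forall_eq 0 fun x => ?_
  obtain ⟨y, rfl⟩ := Ext.covariant_sequence_exact₃ M h x rfl (h₁.elim _ _)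
  rw [h₂.elim y 0, Ext.zero_comp]

lemma ext_middle_left (h : HasSES X Y Z) (N : A) (i : ℕ) (h₁ : Subsingleton (Ext.{w} X N i))
    (h₃ : Subsingleton (Ext.{w} Z N i)) : Subsingleton (Ext.{w} Y N i) := by
  obtain ⟨f, g, w, h⟩ := h
  refine subsingleton_of_forall_eq 0 fun x => ?_
  obtain ⟨y, rfl⟩ := Ext.contravariant_sequence_exact₂ h N x (h₁.elim _ _)
  rw [h₃.elim y 0, Ext.comp_zero]

lemma ext_left_left (h : HasSES X Y Z) (N : A) (i : ℕ) (h₂ : Subsingleton (Ext.{w} Y N i))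
    (h₃ : Subsingleton (Ext.{w} Z N (i + 1))) : Subsingleton (Ext.{w} X N i) := by
  obtain ⟨f, g, w, h⟩ := h
  refine subsingleton_of_forall_eq 0 fun x => ?_
  obtain ⟨y, rfl⟩ := Ext.contravariant_sequence_exact₁ h N x (add_comm 1 i) (h₃.elim _ _)
  rw [h₂.elim y 0, Ext.comp_zero]

lemma ext_right_left (h : HasSES X Y Z) (N : A) (i : ℕ) (h₁ : Subsingleton (Ext.{w} X N i))
    (h₂ : Subsingleton (Ext.{w} Y N (i + 1))) : Subsingleton (Ext.{w} Z N (i + 1)) := by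
  obtain ⟨f, g, w, h⟩ := h
  refine subsingleton_of_forall_eq 0 fun x => ?_
  obtain ⟨y, rfl⟩ := Ext.contravariant_sequence_exact₃ h N x (h₂.elim _ _) (add_comm 1 i)
  rw [h₁.elim y 0, Ext.comp_zero]

lemma nonempty_iso_biprod (h : HasSES X Y Z) (hE : Subsingleton (Ext.{w} Z X 1)) :
    Nonempty (X ⊞ Z ≅ Y) := by
  obtain ⟨f, g, w, h⟩ := h
  -- The obstruction to extending the identity of `X` along `f` lies in `Ext¹(Z, X)`, so a
  -- retraction exists.
  obtain ⟨r, hr⟩ := Ext.contravariant_sequence_exact₁ h X (Ext.mk₀ (𝟙 X)) (add_zero 1)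
    (hE.elim _ _)
  obtain ⟨r, rfl⟩ := Ext.homEquiv₀.symm.surjective r
  have hr' : f ≫ r = 𝟙 X := by
    apply Ext.homEquiv₀.symm.injective
    simpa using hr
  have := h.epi_g
  let s := ShortComplex.Splitting.ofExactOfRetraction _ h.exact r hr' h.epi_g
  exact ⟨(s.isoBinaryBiproduct).symm⟩

end Ext

end HasSES

lemma SES.exists_extension [HasExt.{w} A] {X Y Z : A} {f : X ⟶ Y} {g : Y ⟶ Z} (h : SES f g)
    {N : A} (hE : Subsingleton (Abelian.Ext.{w} Z N 1)) (a : X ⟶ N) : ∃ b : Y ⟶ N, f ≫ b = a := by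
  obtain ⟨b, hb⟩ := Abelian.Ext.contravariant_sequence_exact₁ h.2 N (Abelian.Ext.mk₀ a)
    (add_zero 1) (hE.elim _ _)
  obtain ⟨b, rfl⟩ := Abelian.Ext.homEquiv₀.symm.surjective b
  refine ⟨b, Abelian.Ext.homEquiv₀.symm.injective ?_⟩
  simpa using hb

end ShortExactSequences

/-! ### The right Gorenstein subcategory: coinduction, closure properties, stability. -/

section RightGorenstein

variable {A : Type u} [Category.{v} A] [Abelian A]

open Abelian

/-- A map killed by `e ≫ f` descends to `Z`; surjectivity of restriction along `m` then extends it
to `T`. -/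
lemma SES.function_exact_precomp {X Y Z T S N : A} {f : X ⟶ Y} {g : Y ⟶ Z} (h : SES f g)
    (e : S ⟶ X) [Epi e] (m : Z ⟶ T) (hm : Function.Surjective (fun k : T ⟶ N => m ≫ k)) :
    Function.Exact (fun k : T ⟶ N => (g ≫ m) ≫ k) (fun k : Y ⟶ N => (e ≫ f) ≫ k) := by
  intro y
  constructor
  · intro hy
    have hy' : f ≫ y = 0 := by
      rw [← cancel_epi e, ← Category.assoc, comp_zero]
      exact hy
    obtain ⟨z, rfl⟩ := h.exists_desc y hy'
    obtain ⟨x, rfl⟩ := hm z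
    exact ⟨x, by simp⟩
  · rintro ⟨x, rfl⟩
    simp [reassoc_of% h.zero]

lemma IsExactCoresolution.tail {M : A} {X : ℕ → A} {η : M ⟶ X 0} {d : ∀ i, X i ⟶ X (i + 1)}
    (h : IsExactCoresolution M X η d) :
    IsExactCoresolution (cokernel η) (fun i => X (i + 1)) (cokernel.desc η (d 0) h.zero_aug)
      (fun i => d (i + 1)) := by
  have hd : cokernel.π η ≫ cokernel.desc η (d 0) h.zero_aug = d 0 := cokernel.π_desc _ _ _
  have w : cokernel.desc η (d 0) h.zero_aug ≫ d 1 = 0 := by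
    rw [← cancel_epi (cokernel.π η), reassoc_of% hd, h.zero, comp_zero]
  refine ⟨h.exact_aug.mono_cokernelDesc, w, ?_, fun i => h.zero (i + 1), fun i => h.exact (i + 1)⟩
  let φ : ShortComplex.mk (d 0) (d 1) (h.zero 0) ⟶
      ShortComplex.mk (cokernel.desc η (d 0) h.zero_aug) (d 1) w :=
    { τ₁ := cokernel.π η, τ₂ := 𝟙 _, τ₃ := 𝟙 _ }
  have : Epi φ.τ₁ := by dsimp [φ]; infer_instance
  have : IsIso φ.τ₂ := IsIso.id _
  have : Mono φ.τ₃ := by dsimp [φ]; infer_instance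
  exact (ShortComplex.exact_iff_of_epi_of_isIso_of_mono φ).1 (h.exact 0)

section ClosureProperties

variable (C : ObjectProperty A) [C.IsClosedUnderFiniteProducts]

lemma prop_zero_of_isClosedUnderFiniteProducts : C 0 :=
  C.prop_of_isTerminal 0 (isZero_zero A).isTerminal

lemma prop_biprod_of_isClosedUnderFiniteProducts {X Y : A} (hX : C X) (hY : C Y) :
    C (X ⊞ Y) :=
  C.prop_of_isLimit (BinaryBiproduct.isLimit X Y) (by rintro ⟨_ | _⟩ <;> assumption)

end ClosureProperties

section LeftPerp

variable [HasExt.{w} A] {D : ObjectProperty A} {X Y Z : A}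

lemma leftPerp_middle (h : HasSES X Y Z) (hX : leftPerp.{w} D X) (hZ : leftPerp.{w} D Z) :
    leftPerp.{w} D Y := fun N hN i hi =>
  h.ext_middle_left N i (hX N hN i hi) (hZ N hN i hi)

lemma leftPerp_left (h : HasSES X Y Z) (hY : leftPerp.{w} D Y) (hZ : leftPerp.{w} D Z) :
    leftPerp.{w} D X := fun N hN i hi =>
  h.ext_left_left N i (hY N hN i hi) (hZ N hN (i + 1) (by lia))

lemma leftPerp_of_iso (e : X ≅ Y) (hX : leftPerp.{w} D X) : leftPerp.{w} D Y :=
  fun N hN i hi => HasSES.subsingleton_ext_of_iso e (Iso.refl N) i (hX N hN i hi)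

end LeftPerp

variable [HasExt.{w} A] {C D : ObjectProperty A}

lemma SES.surjective_precomp {X Y Z : A} {f : X ⟶ Y} {g : Y ⟶ Z} (h : SES f g)
    (hZ : leftPerp.{w} D Z) (N : A) (hN : D N) : Function.Surjective (fun k : Y ⟶ N => f ≫ k) :=
  fun a => h.exists_extension (hZ N hN 1 le_rfl) a

/-- A coinduction principle for the right Gorenstein subcategory. -/
lemma rG_of_coinduction (W : ObjectProperty A) (hW : W ≤ leftPerp.{w} D)
    (H : ∀ M, W M → ∃ Y Z : A, HasSES M Y Z ∧ C Y ∧ W Z) : W ≤ rG.{w} C D := by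
  intro M hM
  refine ⟨hW M hM, ?_⟩
  have H' : ∀ M : {M // W M}, ∃ (Y : A) (Z : {Z // W Z}) (f : M.1 ⟶ Y) (g : Y ⟶ Z.1),
      SES f g ∧ C Y := fun M => by
    obtain ⟨Y, Z, ⟨f, g, h⟩, hY, hZ⟩ := H M.1 M.2
    exact ⟨Y, ⟨Z, hZ⟩, f, g, h, hY⟩
  choose Y Z f g h hY using H'
  -- The iterated cosyzygies of `M`. Splicing their sequences gives the coresolution; it is `Hom(-,
  -- D)`-exact because every cosyzygy lies in `leftPerp D`.
  let st : ℕ → {M // W M} := fun i => Nat.rec ⟨M, hM⟩ (fun _ N => Z N) i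
  have hm := fun N => (h N).mono
  have he := fun N => (h N).epi
  have hs := fun N => (h N).surjective_precomp (hW _ (Z N).2)
  have w₀ : f (st 0) ≫ g (st 0) ≫ f (st 1) = 0 := by
    rw [← Category.assoc, (h _).zero, zero_comp]
  have w₁ : ∀ i, (g (st i) ≫ f (st (i + 1))) ≫ g (st (i + 1)) ≫ f (st (i + 2)) = 0 := by
    intro i
    have := (h (st (i + 1))).zero
    simp [reassoc_of% this]
  refine ⟨fun i => Y (st i), f (st 0), fun i => g (st i) ≫ f (st (i + 1)),
    ⟨hm _, w₀, ?_, w₁, fun i => ?_⟩, ⟨hs _, fun N hN => ?_, fun i N hN => ?_⟩,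
    fun i => hY _⟩
  · have := (h (st 0)).exact_comp_epi_mono (𝟙 _) (f (st 1)) (by simpa using w₀)
    simpa using this
  · exact (h (st (i + 1))).exact_comp_epi_mono (g (st i)) (f (st (i + 2))) (w₁ i)
  · have := (h (st 0)).function_exact_precomp (𝟙 _) (f (st 1)) (hs (st 1) N hN)
    simpa using this
  · exact (h (st (i + 1))).function_exact_precomp (g (st i)) (f (st (i + 2)))
      (hs (st (i + 2)) N hN)

/-- The converse of coinduction: the first cosyzygy inherits the tail of the coresolution, so only
its membership in `leftPerp D` needs an argument. -/
lemma exists_hasSES_of_rG (hC : C ≤ leftPerp.{w} D) {M : A} (hM : rG.{w} C D M) :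
    ∃ Y Z : A, HasSES M Y Z ∧ C Y ∧ rG.{w} C D Z := by
  obtain ⟨hM, X, η, d, h, h', hX⟩ := hM
  have := h.mono
  have hη := SES.cokernel η
  refine ⟨X 0, cokernel η, ⟨_, _, hη⟩, hX 0, ?_, ?_⟩
  · intro N hN i hi
    obtain ⟨i, rfl⟩ := Nat.exists_eq_add_of_le' hi
    obtain _ | i := i
    -- In degree 1 shifting fails, as `Hom(M, N)` need not vanish: a class comes from a map `M ⟶ N`,
    -- which extends to `X 0` by `Hom`-exactness, so its connecting image is zero.
    · refine subsingleton_of_forall_eq 0 fun x => ?_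
      obtain ⟨y, rfl⟩ := Ext.contravariant_sequence_exact₃ hη.2 N x
        ((hC _ (hX 0) N hN 1 le_rfl).elim _ _) (add_zero 1)
      obtain ⟨y, rfl⟩ := Ext.homEquiv₀.symm.surjective y
      obtain ⟨z, rfl⟩ := h'.surjective N hN y
      simp only [Ext.homEquiv₀_symm_apply]
      rw [← Ext.mk₀_comp_mk₀, hη.2.extClass_comp_assoc]
    · exact HasSES.ext_right_left ⟨_, _, hη⟩ N (i + 1) (hM N hN (i + 1) (by lia))
        (hC _ (hX 0) N hN _ (by lia))
  · have hd : cokernel.π η ≫ cokernel.desc η (d 0) h.zero_aug = d 0 := cokernel.π_desc _ _ _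
    refine ⟨fun i => X (i + 1), cokernel.desc η (d 0) h.zero_aug, fun i => d (i + 1),
      h.tail, ⟨?_, ?_, fun i => h'.exact (i + 1)⟩, fun i => hX (i + 1)⟩
    · intro N hN k
      obtain ⟨x, hx⟩ := (h'.exact_aug N hN (cokernel.π η ≫ k)).1 (by
        simp)
      refine ⟨x, ?_⟩
      rw [← cancel_epi (cokernel.π η)]
      simpa using hx
    · intro N hN k
      rw [← h'.exact 0 N hN k]
      constructor
      · intro hk
        dsimp at hk ⊢
        rw [← hd, Category.assoc, hk, comp_zero]
      · intro hk
        dsimp at hk ⊢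
        rw [← cancel_epi (cokernel.π η), reassoc_of% hd, hk, comp_zero]

lemma rG_of_iso (hC : C ≤ leftPerp.{w} D) {X Y : A} (e : X ≅ Y) (hX : rG.{w} C D X) :
    rG.{w} C D Y := by
  refine rG_of_coinduction (fun Y => ∃ X, Nonempty (X ≅ Y) ∧ rG.{w} C D X) ?_ ?_ _ ⟨X, ⟨e⟩, hX⟩
  · rintro Y ⟨X, ⟨e⟩, hX⟩
    exact leftPerp_of_iso e hX.1
  · rintro Y ⟨X, ⟨e⟩, hX⟩
    obtain ⟨P, Q, h, hP, hQ⟩ := exists_hasSES_of_rG hC hX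
    exact ⟨P, Q, h.of_iso e (Iso.refl _) (Iso.refl _), hP, Q, ⟨Iso.refl _⟩, hQ⟩

lemma rG_of_hasSES (hC : C ≤ leftPerp.{w} D) {M Y Z : A} (h : HasSES M Y Z)
    (hM : leftPerp.{w} D M) (hY : C Y) (hZ : rG.{w} C D Z) : rG.{w} C D M := by
  refine rG_of_coinduction (fun M => leftPerp.{w} D M ∧
    ∃ Y Z, HasSES M Y Z ∧ C Y ∧ rG.{w} C D Z) (fun M hM => hM.1) ?_ _ ⟨hM, Y, Z, h, hY, hZ⟩
  rintro M ⟨_, Y, Z, h, hY, hZ⟩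
  exact ⟨Y, Z, h, hY, hZ.1, exists_hasSES_of_rG hC hZ⟩

variable [C.IsClosedUnderFiniteProducts]

lemma rG_of_prop (hC : C ≤ leftPerp.{w} D) : C ≤ rG.{w} C D :=
  rG_of_coinduction C hC fun M hM =>
    ⟨M, 0, HasSES.id_zero M, hM, prop_zero_of_isClosedUnderFiniteProducts C⟩

/-- Coinduction on the class of extensions. As `Ext¹(Z, P) = 0`, the pushout of `Y` along `X ⟶ P`
splits as `P ⊞ Z`, so `Y` embeds in `P ⊞ Q`, and the cokernel is an extension of `Z'` by `X'`. -/
lemma rG_middle (hC : C ≤ D ⊓ leftPerp.{w} D) {X Y Z : A} (h : HasSES X Y Z)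
    (hX : rG.{w} C D X) (hZ : rG.{w} C D Z) : rG.{w} C D Y := by
  have hC' : C ≤ leftPerp.{w} D := fun M hM => (hC M hM).2
  refine rG_of_coinduction
    (fun Y => ∃ X Z, HasSES X Y Z ∧ rG.{w} C D X ∧ rG.{w} C D Z) ?_ ?_ _ ⟨X, Z, h, hX, hZ⟩
  · rintro Y ⟨X, Z, h, hX, hZ⟩
    exact leftPerp_middle h hX.1 hZ.1
  · rintro Y ⟨X, Z, h, hX, hZ⟩
    obtain ⟨P, X', hX', hP, hGX'⟩ := exists_hasSES_of_rG hC' hX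
    obtain ⟨Q, Z', hZ', hQ, hGZ'⟩ := exists_hasSES_of_rG hC' hZ
    obtain ⟨Y', h₁, h₂⟩ := h.pushout hX'
    obtain ⟨e⟩ := h₁.nonempty_iso_biprod (hZ.1 P (hC P hP).1 1 le_rfl)
    obtain ⟨R, h₃, h₄⟩ := (h₂.of_iso (Iso.refl _) e.symm (Iso.refl _)).comp_mono
      (hZ'.biprod_right P)
    exact ⟨P ⊞ Q, R, h₃, prop_biprod_of_isClosedUnderFiniteProducts C hP hQ,
      X', Z', h₄, hGX', hGZ'⟩

/-- With `Y` embedded in `P`, the quotient `P/X` is an extension of `P/Y` by `Y/X = Z`, hence in the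
subcategory. -/
lemma rG_left (hC : C ≤ D ⊓ leftPerp.{w} D) {X Y Z : A} (h : HasSES X Y Z)
    (hY : rG.{w} C D Y) (hZ : rG.{w} C D Z) : rG.{w} C D X := by
  have hC' : C ≤ leftPerp.{w} D := fun M hM => (hC M hM).2
  obtain ⟨P, Y', hY', hP, hGY'⟩ := exists_hasSES_of_rG hC' hY
  obtain ⟨Q, h₁, h₂⟩ := h.comp_mono hY'
  exact rG_of_hasSES hC' h₁ (leftPerp_left h hY.1 hZ.1) hP (rG_middle hC h₂ hZ hGY')

/-- The right Gorenstein subcategory is stable: objects of `⊥D` coresolved by it, with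
cosyzygies in `⊥D`, belong to it. -/
lemma rG_of_coinduction_rG (hC : C ≤ D ⊓ leftPerp.{w} D) (W : ObjectProperty A)
    (hW : W ≤ leftPerp.{w} D)
    (H : ∀ M, W M → ∃ Y Z : A, HasSES M Y Z ∧ rG.{w} C D Y ∧ W Z) : W ≤ rG.{w} C D := by
  have hC' : C ≤ leftPerp.{w} D := fun M hM => (hC M hM).2
  have h0 : rG.{w} C D 0 := rG_of_prop hC' _ (prop_zero_of_isClosedUnderFiniteProducts C)
  intro M hM
  -- The class is enlarged to extensions of objects of `rG C D` by objects of `W`, since the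
  -- cokernel of an embedding into `C` need not stay in `W`.
  refine rG_of_coinduction (fun Q => ∃ X Y, HasSES X Q Y ∧ W X ∧ rG.{w} C D Y) ?_ ?_ _
    ⟨M, 0, HasSES.id_zero M, hM, h0⟩
  · rintro Q ⟨X, Y, h, hX, hY⟩
    exact leftPerp_middle h (hW X hX) hY.1
  · rintro Q ⟨X, Y, h, hX, hY⟩
    obtain ⟨G, X', h₁, hG, hX'⟩ := H X hX
    -- `Q'` is an extension of `Y` by `G`, so it embeds in some `P` from `C`; then `P/Q` is an
    -- extension of `Y' = P/Q'` by `X' = Q'/Q`.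
    obtain ⟨Q', h₂, h₃⟩ := h.pushout h₁
    obtain ⟨P, Y', h₄, hP, hY'⟩ := exists_hasSES_of_rG hC' (rG_middle hC h₂ hG hY)
    obtain ⟨R, h₅, h₆⟩ := h₃.comp_mono h₄
    exact ⟨P, R, h₅, hP, X', Y', h₆, hX', hY'⟩

end RightGorenstein

/-! ### Dimensions as infima versus step-by-step resolutions. -/

section FiniteDimension

variable {A : Type u} [Category.{v} A] [Abelian A]

open Abelian

/-- The objects `M` with an exact sequence `0 ⟶ X n ⟶ ⋯ ⟶ X 0 ⟶ M ⟶ 0` with all `X i` in `P`,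
built one short exact sequence at a time. -/
def PdLE (P : ObjectProperty A) : ℕ → ObjectProperty A
  | 0 => P
  | n + 1 => fun M => ∃ K X : A, HasSES K X M ∧ P X ∧ PdLE P n K

variable {P Q : ObjectProperty A}

lemma PdLE.mono (h : P ≤ Q) {n : ℕ} {M : A} (hM : PdLE P n M) : PdLE Q n M := by
  induction n generalizing M with
  | zero => exact h _ hM
  | succ n ih =>
    obtain ⟨K, X, hs, hX, hK⟩ := hM
    exact ⟨K, X, hs, h _ hX, ih hK⟩

lemma PdLE.succ (h0 : P 0) {n : ℕ} {M : A} (hM : PdLE P n M) : PdLE P (n + 1) M := by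
  induction n generalizing M with
  | zero => exact ⟨0, M, HasSES.zero_id M, hM, h0⟩
  | succ n ih =>
    obtain ⟨K, X, hs, hX, hK⟩ := hM
    exact ⟨K, X, hs, hX, ih hK⟩

lemma PdLE.of_le (h0 : P 0) {m n : ℕ} (hmn : m ≤ n) {M : A} (hM : PdLE P m M) :
    PdLE P n M := by
  induction n, hmn using Nat.le_induction with
  | base => exact hM
  | succ n _ ih => exact ih.succ h0

lemma PdLE.of_iso [P.IsClosedUnderIsomorphisms] {n : ℕ} {M N : A} (e : M ≅ N)
    (hM : PdLE P n M) : PdLE P n N := by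
  cases n with
  | zero => exact P.prop_of_iso e hM
  | succ n =>
    obtain ⟨K, X, hs, hX, hK⟩ := hM
    exact ⟨K, X, hs.of_iso (Iso.refl _) (Iso.refl _) e, hX, hK⟩

lemma IsExactResolution.tail {M : A} {X : ℕ → A} {d : ∀ i, X (i + 1) ⟶ X i} {ε : X 0 ⟶ M}
    (h : IsExactResolution M X d ε) :
    IsExactResolution (kernel ε) (fun i => X (i + 1)) (fun i => d (i + 1))
      (kernel.lift ε (d 0) h.zero_aug) := by
  have hd : kernel.lift ε (d 0) h.zero_aug ≫ kernel.ι ε = d 0 := kernel.lift_ι _ _ _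
  have w : d 1 ≫ kernel.lift ε (d 0) h.zero_aug = 0 := by
    rw [← cancel_mono (kernel.ι ε), Category.assoc, hd, h.zero, zero_comp]
  refine ⟨h.exact_aug.epi_kernelLift, w, ?_, fun i => h.zero (i + 1), fun i => h.exact (i + 1)⟩
  let φ : ShortComplex.mk (d 1) (kernel.lift ε (d 0) h.zero_aug) w ⟶
      ShortComplex.mk (d 1) (d 0) (h.zero 0) :=
    { τ₁ := 𝟙 _, τ₂ := 𝟙 _, τ₃ := kernel.ι ε }
  have : Epi φ.τ₁ := by dsimp [φ]; infer_instance
  have : IsIso φ.τ₂ := IsIso.id _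
  have : Mono φ.τ₃ := by dsimp [φ]; infer_instance
  exact (ShortComplex.exact_iff_of_epi_of_isIso_of_mono φ).2 (h.exact 0)

/-- Prepend an object to a sequence of objects. -/
def consObj (Y : A) (X : ℕ → A) : ℕ → A
  | 0 => Y
  | i + 1 => X i

/-- Prepend a morphism to a chain of morphisms going down. -/
def consDown {Y : A} {X : ℕ → A} (f : X 0 ⟶ Y) (d : ∀ i, X (i + 1) ⟶ X i) :
    ∀ i, consObj Y X (i + 1) ⟶ consObj Y X i
  | 0 => f
  | i + 1 => d i

/-- Prepend a morphism to a chain of morphisms going up. -/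
def consUp {Y : A} {X : ℕ → A} (f : Y ⟶ X 0) (d : ∀ i, X i ⟶ X (i + 1)) :
    ∀ i, consObj Y X i ⟶ consObj Y X (i + 1)
  | 0 => f
  | i + 1 => d i

lemma IsExactResolution.cons {M K Y : A} {X : ℕ → A} {d : ∀ i, X (i + 1) ⟶ X i} {ε : X 0 ⟶ K}
    (h : IsExactResolution K X d ε) {f : K ⟶ Y} {g : Y ⟶ M} (hs : SES f g) :
    IsExactResolution M (consObj Y X) (consDown (ε ≫ f) d) g := by
  have := h.epi
  have := hs.mono
  have w : (ε ≫ f) ≫ g = 0 := by rw [Category.assoc, hs.zero, comp_zero]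
  have w' : d 0 ≫ ε ≫ f = 0 := by rw [← Category.assoc, h.zero_aug, zero_comp]
  refine ⟨hs.epi, w, ?_, ?_, ?_⟩
  · have := hs.exact_comp_epi_mono ε (𝟙 M) (by simpa using w)
    simp only [Category.comp_id] at this
    exact this
  · rintro (_ | i)
    · exact w'
    · exact h.zero i
  · rintro (_ | i)
    · let φ : ShortComplex.mk (d 0) ε h.zero_aug ⟶ ShortComplex.mk (d 0) (ε ≫ f) w' :=
        { τ₁ := 𝟙 _, τ₂ := 𝟙 _, τ₃ := f }
      have : Epi φ.τ₁ := by dsimp [φ]; infer_instance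
      have : IsIso φ.τ₂ := IsIso.id _
      have : Mono φ.τ₃ := by dsimp [φ]; infer_instance
      exact (ShortComplex.exact_iff_of_epi_of_isIso_of_mono φ).1 h.exact_aug
    · exact h.exact i

lemma IsExactCoresolution.cons {M K Y : A} {X : ℕ → A} {η : K ⟶ X 0} {d : ∀ i, X i ⟶ X (i + 1)}
    (h : IsExactCoresolution K X η d) {f : M ⟶ Y} {g : Y ⟶ K} (hs : SES f g) :
    IsExactCoresolution M (consObj Y X) f (consUp (g ≫ η) d) := by
  have := h.mono
  have := hs.epi
  have w : f ≫ g ≫ η = 0 := by rw [← Category.assoc, hs.zero, zero_comp]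
  have w' : (g ≫ η) ≫ d 0 = 0 := by rw [Category.assoc, h.zero_aug, comp_zero]
  refine ⟨hs.mono, w, ?_, ?_, ?_⟩
  · have := hs.exact_comp_epi_mono (𝟙 M) η (by simpa using w)
    simp only [Category.id_comp] at this
    exact this
  · rintro (_ | i)
    · exact w'
    · exact h.zero i
  · rintro (_ | i)
    · let φ : ShortComplex.mk (g ≫ η) (d 0) w' ⟶ ShortComplex.mk η (d 0) h.zero_aug :=
        { τ₁ := g, τ₂ := 𝟙 _, τ₃ := 𝟙 _ }
      have : Epi φ.τ₁ := by dsimp [φ]; infer_instance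
      have : IsIso φ.τ₂ := IsIso.id _
      have : Mono φ.τ₃ := by dsimp [φ]; infer_instance
      exact (ShortComplex.exact_iff_of_epi_of_isIso_of_mono φ).2 h.exact_aug
    · exact h.exact i

lemma isExactResolution_zero :
    IsExactResolution (0 : A) (fun _ => 0) (fun _ => 0) 0 :=
  ⟨inferInstance, by simp, ShortComplex.exact_of_isZero_X₂ _ (isZero_zero A), by simp,
    fun _ => ShortComplex.exact_of_isZero_X₂ _ (isZero_zero A)⟩

lemma isExactCoresolution_zero :
    IsExactCoresolution (0 : A) (fun _ => 0) 0 (fun _ => 0) :=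
  ⟨inferInstance, by simp, ShortComplex.exact_of_isZero_X₂ _ (isZero_zero A), by simp,
    fun _ => ShortComplex.exact_of_isZero_X₂ _ (isZero_zero A)⟩

lemma HasResolutionOfLength.pdLE [P.IsClosedUnderIsomorphisms] {n : ℕ} {M : A}
    (h : HasResolutionOfLength P M n) : PdLE P n M := by
  obtain ⟨X, d, ε, h, hX, hX'⟩ := h
  have := h.epi
  induction n generalizing M X with
  | zero =>
    have : Mono ε := h.exact_aug.mono_g ((hX' 1 (by lia)).eq_of_src _ _)
    have := isIso_of_mono_of_epi ε
    exact P.prop_of_iso (asIso ε) (hX 0 le_rfl)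
  | succ n ih =>
    exact ⟨_, _, ⟨_, _, SES.kernel ε⟩, hX 0 (by lia), ih _ _ _ h.tail
      (fun i hi => hX (i + 1) (by lia)) (fun i hi => hX' (i + 1) (by lia)) h.tail.epi⟩

lemma PdLE.hasResolutionOfLength {n : ℕ} {M : A} (h : PdLE P n M) :
    HasResolutionOfLength P M n := by
  induction n generalizing M with
  | zero =>
    obtain ⟨f, g, hs⟩ := HasSES.zero_id M
    refine ⟨_, _, _, isExactResolution_zero.cons hs, ?_, ?_⟩
    · intro i hi
      obtain rfl : i = 0 := by lia
      exact h
    · rintro (_ | i) hi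
      · lia
      · exact isZero_zero A
  | succ n ih =>
    obtain ⟨K, Y, ⟨f, g, hs⟩, hY, hK⟩ := h
    obtain ⟨X, d, ε, h, hX, hX'⟩ := ih hK
    refine ⟨_, _, _, h.cons hs, ?_, ?_⟩
    · rintro (_ | i) hi
      · exact hY
      · exact hX i (by lia)
    · rintro (_ | i) hi
      · lia
      · exact hX' i (by lia)

lemma exists_of_iInf_le {p : ℕ → Prop} {n : ℕ}
    (h : (⨅ (m : ℕ) (_ : p m), (m : ℕ∞)) ≤ n) : ∃ m ≤ n, p m := by
  by_contra! H
  have h' : ((n + 1 : ℕ) : ℕ∞) ≤ ⨅ (m : ℕ) (_ : p m), (m : ℕ∞) :=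
    le_iInf₂ fun m hm => by
      by_contra hlt
      refine H m ?_ hm
      have : m < n + 1 := by exact_mod_cast not_le.1 hlt
      lia
  have : n + 1 ≤ n := by exact_mod_cast h'.trans h
  lia

/-- An infimum in `ℕ∞` below a finite bound is at least one admissible length `m ≤ n`, and that
resolution is padded with zero objects to length `n`. -/
lemma relPd_le_iff [P.IsClosedUnderIsomorphisms] (h0 : P 0) (M : A) (n : ℕ) :
    relPd P M ≤ n ↔ PdLE P n M := by
  refine ⟨fun h => ?_, fun h => iInf₂_le n h.hasResolutionOfLength⟩
  obtain ⟨m, hm, h⟩ := exists_of_iInf_le h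
  exact h.pdLE.of_le h0 hm

lemma HasSES.hasInjectiveDimensionLT_left {X Y Z : A} (h : HasSES X Y Z) (n : ℕ)
    (hZ : HasInjectiveDimensionLT Z n) (hY : HasInjectiveDimensionLT Y (n + 1)) :
    HasInjectiveDimensionLT X (n + 1) := by
  obtain ⟨f, g, w, h⟩ := h
  exact h.hasInjectiveDimensionLT_X₁ n hZ hY

lemma HasSES.hasInjectiveDimensionLT_right {X Y Z : A} (h : HasSES X Y Z) (n : ℕ)
    (hY : HasInjectiveDimensionLT Y n) (hX : HasInjectiveDimensionLT X (n + 1)) :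
    HasInjectiveDimensionLT Z n := by
  obtain ⟨f, g, w, h⟩ := h
  exact h.hasInjectiveDimensionLT_X₃ n hY hX

lemma HasCoresolutionOfLength.hasInjectiveDimensionLT {n : ℕ} {M : A}
    (h : HasCoresolutionOfLength (isInjective A) M n) : HasInjectiveDimensionLT M (n + 1) := by
  obtain ⟨X, η, d, h, hX, hX'⟩ := h
  have := h.mono
  induction n generalizing M X with
  | zero =>
    have : Epi η := h.exact_aug.epi_f ((hX' 1 (by lia)).eq_of_tgt _ _)
    have := isIso_of_mono_of_epi η
    have : Injective (X 0) := hX 0 le_rfl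
    exact hasInjectiveDimensionLT_of_iso (asIso η).symm 1
  | succ n ih =>
    have : Injective (X 0) := hX 0 (by lia)
    exact HasSES.hasInjectiveDimensionLT_left ⟨_, _, SES.cokernel η⟩ _
      (ih _ _ _ h.tail (fun i hi => hX (i + 1) (by lia)) (fun i hi => hX' (i + 1) (by lia))
        h.tail.mono) (hasInjectiveDimensionLT_of_ge _ 1 _ (by lia))

lemma exists_hasSES_injective [EnoughInjectives A] (M : A) :
    ∃ I Z : A, HasSES M I Z ∧ Injective I :=
  ⟨_, _, ⟨_, _, SES.cokernel (Injective.ι M)⟩, inferInstance⟩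

lemma hasCoresolutionOfLength_of_hasInjectiveDimensionLT [EnoughInjectives A] {n : ℕ} {M : A}
    (h : HasInjectiveDimensionLT M (n + 1)) :
    HasCoresolutionOfLength (isInjective A) M n := by
  induction n generalizing M with
  | zero =>
    obtain ⟨f, g, hs⟩ := HasSES.id_zero M
    refine ⟨_, _, _, isExactCoresolution_zero.cons hs, ?_, ?_⟩
    · intro i hi
      obtain rfl : i = 0 := by lia
      exact injective_iff_hasInjectiveDimensionLT_one.2 h
    · rintro (_ | i) hi
      · lia
      · exact isZero_zero A
  | succ n ih =>
    obtain ⟨I, Z, hs', hI⟩ := exists_hasSES_injective M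
    obtain ⟨f, g, hs⟩ := id hs'
    obtain ⟨X, η, d, h, hX, hX'⟩ := ih (hs'.hasInjectiveDimensionLT_right _
      (hasInjectiveDimensionLT_of_ge _ 1 _ (by lia)) h)
    refine ⟨_, _, _, h.cons hs, ?_, ?_⟩
    · rintro (_ | i) hi
      · exact hI
      · exact hX i (by lia)
    · rintro (_ | i) hi
      · lia
      · exact hX' i (by lia)

lemma injDim_le_iff [EnoughInjectives A] (M : A) (n : ℕ) :
    injDim M ≤ n ↔ HasInjectiveDimensionLT M (n + 1) := by
  refine ⟨fun h => ?_, fun h =>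
    iInf₂_le n (hasCoresolutionOfLength_of_hasInjectiveDimensionLT h)⟩
  obtain ⟨m, hm, h⟩ := exists_of_iInf_le h
  have := h.hasInjectiveDimensionLT
  -- The bound in `HasInjectiveDimensionLT` is strict, hence the shift by one.
  exact hasInjectiveDimensionLT_of_ge _ (m + 1) _ (by lia)

end FiniteDimension

/-! ### Syzygies, horseshoes, and comparison of the dimensions. -/

section Gorenstein

variable {A : Type u} [Category.{v} A] [Abelian A]

open Abelian

/-- `Syz n M K` means that `K` is an `n`-th syzygy of `M` in a projective resolution. -/
inductive Syz : ℕ → A → A → Prop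
  | refl (M : A) : Syz 0 M M
  | step {n : ℕ} {M M' P K : A} (h : HasSES M' P M) (hP : Projective P) (hK : Syz n M' K) :
      Syz (n + 1) M K

lemma exists_hasSES_projective [EnoughProjectives A] (M : A) :
    ∃ K P : A, HasSES K P M ∧ Projective P :=
  ⟨_, _, ⟨_, _, SES.kernel (Projective.π M)⟩, inferInstance⟩

lemma exists_syz [EnoughProjectives A] (n : ℕ) (M : A) : ∃ K, Syz n M K := by
  induction n generalizing M with
  | zero => exact ⟨M, .refl M⟩
  | succ n ih =>
    obtain ⟨K, P, h, hP⟩ := exists_hasSES_projective M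
    obtain ⟨L, hL⟩ := ih K
    exact ⟨L, .step h hP hL⟩

variable {P : ObjectProperty A}

lemma Syz.pdLE (hP : isProjective A ≤ P) {n : ℕ} {M K : A} (h : Syz n M K) (hK : P K) :
    PdLE P n M := by
  induction h with
  | refl M => exact hK
  | step h hP' _ ih => exact ⟨_, _, h, hP _ hP', ih hK⟩

/-- Only the degree-zero term `G` of the resolution of `Y` changes: it is replaced by the kernel of
`G ⟶ Y ⟶ Z`. -/
lemma PdLE.left_of_closedUnderKernelsOfEpis (hP : ClosedUnderKernelsOfEpis P) {n : ℕ}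
    {X Y Z : A} (h : HasSES X Y Z) (hY : PdLE P n Y) (hZ : P Z) : PdLE P n X := by
  cases n with
  | zero =>
    obtain ⟨f, g, w, h⟩ := h
    exact hP _ h hY hZ
  | succ n =>
    obtain ⟨K, G, h', hG, hK⟩ := hY
    obtain ⟨Q, h₁, h₂⟩ := h.comp_epi h'
    obtain ⟨f, g, w, h₁⟩ := h₁
    exact ⟨K, Q, h₂, hP _ h₁ hG hZ, hK⟩

lemma PdLE.biprod (hP : ∀ {X Y : A}, P X → P Y → P (X ⊞ Y)) {n : ℕ} {X Y : A}
    (hX : P X) (hY : PdLE P n Y) : PdLE P n (X ⊞ Y) := by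
  cases n with
  | zero => exact hP hX hY
  | succ n =>
    obtain ⟨K, G, h, hG, hK⟩ := hY
    exact ⟨K, X ⊞ G, h.biprod_left X, hP hX hG, hK⟩

lemma subsingleton_ext_of_projective [HasExt.{w} A] (P N : A) [Projective P] {i : ℕ} (hi : 1 ≤ i) :
    Subsingleton (Ext.{w} P N i) := by
  obtain ⟨i, rfl⟩ := Nat.exists_eq_add_of_le' hi
  exact subsingleton_of_forall_eq 0 fun x => Ext.eq_zero_of_projective x

/-- Schanuel's argument: the pullback of `X ⟶ M` and `Q ⟶ M` is `L ⊞ Q` because `Q` is projective,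
and `M'` is the kernel of its epimorphism onto `X`. So `M'` has dimension one less than the bound
for `M`. -/
lemma Syz.prop_of_pdLE [P.IsClosedUnderIsomorphisms] (hP : isProjective A ≤ P)
    (hP' : ∀ {X Y : A}, P X → P Y → P (X ⊞ Y)) (hk : ClosedUnderKernelsOfEpis P) {n : ℕ}
    {M K : A} (h : Syz n M K) (hM : PdLE P n M) : P K := by
  induction h with
  | refl M => exact hM
  | @step n M M' Q K h hQ _ ih =>
    obtain ⟨L, X, h', hX, hL⟩ := hM
    obtain ⟨E, h₁, h₂⟩ := h'.pullback h
    let := HasExt.standard A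
    obtain ⟨e⟩ := h₁.nonempty_iso_biprod (subsingleton_ext_of_projective _ _ le_rfl)
    exact ih (PdLE.left_of_closedUnderKernelsOfEpis hk h₂
      ((PdLE.biprod hP' (hP _ hQ) hL).of_iso (biprod.braiding Q L ≪≫ e)) hX)

lemma HasInjectiveDimensionLT.of_pdLE {n : ℕ}
    (hP : ∀ Y, P Y → HasInjectiveDimensionLT Y (n + 1)) {m : ℕ} {M : A} (hM : PdLE P m M) :
    HasInjectiveDimensionLT M (n + 1) := by
  induction m generalizing M with
  | zero => exact hP M hM
  | succ m ih =>
    obtain ⟨K, X, h, hX, hK⟩ := hM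
    have := ih hK
    exact h.hasInjectiveDimensionLT_right _ (hP X hX)
      (hasInjectiveDimensionLT_of_ge _ (n + 1) _ (by lia))

lemma retract_of_iso_biprod {X Y Z : A} (e : X ⊞ Z ≅ Y) : Nonempty (Retract X Y) :=
  ⟨{ i := biprod.inl ≫ e.hom, r := e.inv ≫ biprod.fst, retract := by simp }⟩

section Ext

variable [HasExt.{w} A]

lemma Syz.subsingleton_ext {n : ℕ} {M K : A} (h : Syz n M K) (N : A)
    (hM : ∀ i, n + 1 ≤ i → Subsingleton (Ext.{w} M N i)) (i : ℕ) (hi : 1 ≤ i) :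
    Subsingleton (Ext.{w} K N i) := by
  induction h with
  | refl M => exact hM i (by lia)
  | step h hP _ ih =>
    exact ih fun j hj => h.ext_left_left N j (subsingleton_ext_of_projective _ _ (by lia))
      (hM _ (by lia))

/-- A form of the horseshoe lemma: `X₁ ⟶ P ⟶ X` and `Z₁ ⟶ Q ⟶ Z` are combined, when
`Ext¹(Q, X) = 0`. -/
lemma HasSES.horseshoe {X Y Z X₁ P Z₁ Q : A} (h : HasSES X Y Z) (hX : HasSES X₁ P X)
    (hZ : HasSES Z₁ Q Z) (hE : Subsingleton (Ext.{w} Q X 1)) :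
    ∃ Y₁ : A, HasSES Y₁ (Q ⊞ P) Y ∧ HasSES X₁ Y₁ Z₁ := by
  obtain ⟨E, h₁, h₂⟩ := h.pullback hZ
  obtain ⟨e⟩ := h₁.nonempty_iso_biprod hE
  exact h₂.comp_epi ((hX.biprod_left Q).of_iso (Iso.refl _) (Iso.refl _)
    (biprod.braiding Q X ≪≫ e))

lemma Syz.horseshoe [EnoughProjectives A] {n : ℕ} {M K : A} (hK : Syz n M K) {I N : A}
    (h : HasSES M I N) : ∃ K' K'' : A, Syz n I K' ∧ Syz n N K'' ∧ HasSES K K' K'' := by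
  induction hK generalizing I N with
  | refl M => exact ⟨I, N, .refl I, .refl N, h⟩
  | @step n M M' P K h' hP _ ih =>
    obtain ⟨N', Q, hN, hQ⟩ := exists_hasSES_projective N
    obtain ⟨I', h₁, h₂⟩ := h.horseshoe h' hN
      (subsingleton_ext_of_projective.{w} _ _ le_rfl)
    obtain ⟨K', K'', hK', hK'', h₃⟩ := ih h₂
    exact ⟨K', K'', .step h₁ inferInstance hK', .step hN hQ hK'', h₃⟩

variable {C D : ObjectProperty A}

lemma PdLE.subsingleton_ext_of_leftPerp (hP : P ≤ leftPerp.{w} D) {n : ℕ} {M N : A}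
    (hM : PdLE P n M) (hN : D N) (i : ℕ) (hi : n + 1 ≤ i) : Subsingleton (Ext.{w} M N i) := by
  induction n generalizing M i with
  | zero => exact hP _ hM N hN i hi
  | succ n ih =>
    obtain ⟨K, X, h, hX, hK⟩ := hM
    obtain ⟨i, rfl⟩ := Nat.exists_eq_add_of_le' (show 1 ≤ i by lia)
    exact h.ext_right_left N i (ih hK i (by lia)) (hP _ hX N hN _ (by lia))

lemma leftPerp.subsingleton_ext_of_pdLE {M : A} (hM : leftPerp.{w} D M) {n : ℕ} {L : A}
    (hL : PdLE D n L) (i : ℕ) (hi : 1 ≤ i) : Subsingleton (Ext.{w} M L i) := by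
  induction n generalizing L i with
  | zero => exact hM L hL i hi
  | succ n ih =>
    obtain ⟨K, X, h, hX, hK⟩ := hL
    exact h.ext_right_right M i (hM X hX i hi) (ih hK (i + 1) (by lia))

lemma hasInjectiveDimensionLT_of_forall_pdLE (hP : P ≤ leftPerp.{w} D) {n : ℕ}
    (h : ∀ M, PdLE P n M) (Y : A) (hY : D Y) : HasInjectiveDimensionLT Y (n + 1) :=
  HasInjectiveDimensionLT.mk fun i hi M e =>
    ((h M).subsingleton_ext_of_leftPerp hP hY i hi).elim e 0

variable [C.IsClosedUnderFiniteProducts]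

lemma rG_closedUnderKernelsOfEpis (hC : C ≤ D ⊓ leftPerp.{w} D) :
    ClosedUnderKernelsOfEpis (rG.{w} C D) :=
  fun S hS h₂ h₃ => rG_left hC ⟨S.f, S.g, S.zero, hS⟩ h₂ h₃

lemma pdLE_rG_of_injective [EnoughProjectives A] [EnoughInjectives A]
    (hC : C ≤ D ⊓ leftPerp.{w} D) (hP : isProjective A ≤ rG.{w} C D) {n : ℕ}
    (hI : ∀ I : A, Injective I → PdLE (rG.{w} C D) n I)
    (hD : ∀ Y, D Y → HasInjectiveDimensionLT Y (n + 1)) (M : A) :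
    PdLE (rG.{w} C D) n M := by
  have hC' : C ≤ leftPerp.{w} D := fun M hM => (hC M hM).2
  have : (rG.{w} C D).IsClosedUnderIsomorphisms := ⟨fun e h => rG_of_iso hC' e h⟩
  obtain ⟨K, hK⟩ := exists_syz n M
  -- All `n`-th syzygies are treated at once: the cokernel built below is a syzygy of another object
  -- `N`, so the class must range over all objects.
  refine hK.pdLE hP (rG_of_coinduction_rG hC (fun K => ∃ M, Syz n M K) ?_ ?_ _ ⟨M, hK⟩)
  · rintro K ⟨M, hK⟩ Y hY i hi
    have := hD Y hY
    exact hK.subsingleton_ext Y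
      (fun j hj => HasInjectiveDimensionLT.subsingleton Y (n + 1) j hj M) i hi
  · rintro K ⟨M, hK⟩
    obtain ⟨I, N, h, hI'⟩ := exists_hasSES_injective M
    obtain ⟨K', K'', hK', hK'', h'⟩ := hK.horseshoe.{w} h
    exact ⟨K', K'', h', hK'.prop_of_pdLE hP (fun hX hY => rG_middle hC (HasSES.biprod _ _) hX hY)
      (rG_closedUnderKernelsOfEpis hC) (hI I hI'), N, hK''⟩

/-- Every object of finite right Gorenstein dimension embeds into an object of finite
`C`-dimension, with cokernel in the right Gorenstein subcategory. -/
lemma PdLE.exists_hasSES_of_rG (hC : C ≤ D ⊓ leftPerp.{w} D) {n : ℕ} {M : A}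
    (hM : PdLE (rG.{w} C D) n M) :
    ∃ L G : A, HasSES M L G ∧ PdLE C n L ∧ rG.{w} C D G := by
  have hC' : C ≤ leftPerp.{w} D := fun M hM => (hC M hM).2
  induction n generalizing M with
  | zero => exact RelGor.exists_hasSES_of_rG hC' hM
  | succ n ih =>
    obtain ⟨K, X, h, hX, hK⟩ := hM
    obtain ⟨L, G, h₁, hL, hG⟩ := ih hK
    -- `X'` is an extension of `G` by `X`, so it embeds in some `Y` from `C`. The object sought is
    -- `Y/L`: it contains `M = X'/L` with quotient `G' = Y/X'`.
    obtain ⟨X', h₂, h₃⟩ := h.pushout h₁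
    obtain ⟨Y, G', h₄, hY, hG'⟩ := RelGor.exists_hasSES_of_rG hC' (rG_middle hC h₃ hX hG)
    obtain ⟨L', h₅, h₆⟩ := h₂.comp_mono h₄
    exact ⟨L', G', h₆, ⟨L, Y, h₅, hY, hL⟩, hG'⟩

lemma pdLE_of_injective_of_pdLE_rG [C.IsStableUnderRetracts] (hC : C ≤ D ⊓ leftPerp.{w} D)
    {n : ℕ} {I : A} [Injective I] (hI : PdLE (rG.{w} C D) n I) : PdLE C n I := by
  obtain ⟨L, G, h, hL, hG⟩ := hI.exists_hasSES_of_rG hC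
  have hE : Subsingleton (Ext.{w} G I 1) :=
    HasInjectiveDimensionLT.subsingleton I 1 1 le_rfl G
  cases n with
  | zero =>
    obtain ⟨e⟩ := h.nonempty_iso_biprod hE
    obtain ⟨r⟩ := retract_of_iso_biprod e
    exact C.prop_of_retract r hL
  | succ n =>
    obtain ⟨L₁, X, h₁, hX, hL₁⟩ := hL
    -- Splitting `L` itself would need summand closure for `C`-dimension. Instead `Q`, the preimage
    -- of `I` in `X`, is shown to be a summand of `X`; it then starts a `C`-resolution of `I` with
    -- kernel `L₁`.
    obtain ⟨Q, h₂, h₃⟩ := h.comp_epi h₁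
    have hQ : Subsingleton (Ext.{w} G Q 1) := h₃.ext_middle_right G 1
      (hG.1.subsingleton_ext_of_pdLE (hL₁.mono fun M hM => (hC M hM).1) 1 le_rfl) hE
    obtain ⟨e⟩ := h₂.nonempty_iso_biprod hQ
    obtain ⟨r⟩ := retract_of_iso_biprod e
    exact ⟨L₁, Q, h₃, C.prop_of_retract r hX, hL₁⟩

/-- The horseshoe applies with terms in `C` because `Q` lies in `leftPerp D` and `X` has finite
`D`-dimension, so `Ext¹(Q, X) = 0`. -/
lemma PdLE.middle [C.IsClosedUnderIsomorphisms] (hC : C ≤ D ⊓ leftPerp.{w} D) {n : ℕ}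
    {X Y Z : A} (h : HasSES X Y Z) (hX : PdLE C n X) (hZ : PdLE C n Z) : PdLE C n Y := by
  induction n generalizing X Y Z with
  | zero =>
    obtain ⟨e⟩ := h.nonempty_iso_biprod ((hC Z hZ).2 X (hC X hX).1 1 le_rfl)
    exact C.prop_of_iso e (prop_biprod_of_isClosedUnderFiniteProducts C hX hZ)
  | succ n ih =>
    have hXD : PdLE D (n + 1) X := hX.mono fun M hM => (hC M hM).1
    obtain ⟨X₁, P, hXs, hP, hX₁⟩ := hX
    obtain ⟨Z₁, Q, hZs, hQ, hZ₁⟩ := hZ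
    obtain ⟨Y₁, h₁, h₂⟩ := h.horseshoe hXs hZs
      (leftPerp.subsingleton_ext_of_pdLE (hC Q hQ).2 hXD 1 le_rfl)
    exact ⟨Y₁, Q ⊞ P, h₁, prop_biprod_of_isClosedUnderFiniteProducts C hQ hP, ih h₂ hX₁ hZ₁⟩

/-- Pulling `Y` back along `Q ⟶ Z` reduces to a quotient in `C`: the pullback `E` is an extension of
`Y` by `Z₁`, and `X` is the kernel of `E ⟶ Q`. -/
lemma PdLE.left [C.IsClosedUnderIsomorphisms] (hC : C ≤ D ⊓ leftPerp.{w} D)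
    (hk : ClosedUnderKernelsOfEpis C) {n : ℕ} {X Y Z : A} (h : HasSES X Y Z)
    (hY : PdLE C n Y) (hZ : PdLE C n Z) : PdLE C n X := by
  cases n with
  | zero => exact PdLE.left_of_closedUnderKernelsOfEpis hk h hY hZ
  | succ n =>
    obtain ⟨Z₁, Q, hZs, hQ, hZ₁⟩ := hZ
    obtain ⟨E, h₁, h₂⟩ := h.pullback hZs
    exact PdLE.left_of_closedUnderKernelsOfEpis hk h₁ (PdLE.middle hC h₂
      (hZ₁.succ (prop_zero_of_isClosedUnderFiniteProducts C)) hY) hQ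

lemma pdLE_of_hasInjectiveDimensionLT [EnoughInjectives A] [C.IsClosedUnderIsomorphisms]
    (hC : C ≤ D ⊓ leftPerp.{w} D) (hk : ClosedUnderKernelsOfEpis C) {n : ℕ}
    (hI : ∀ I : A, Injective I → PdLE C n I) {m : ℕ} {M : A}
    (hM : HasInjectiveDimensionLT M (m + 1)) : PdLE C n M := by
  induction m generalizing M with
  | zero => exact hI M (injective_iff_hasInjectiveDimensionLT_one.2 hM)
  | succ m ih =>
    obtain ⟨I, Z, h, hI'⟩ := exists_hasSES_injective M
    exact PdLE.left hC hk h (hI I hI') (ih (h.hasInjectiveDimensionLT_right _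
      (hasInjectiveDimensionLT_of_ge _ 1 _ (by lia)) hM))

end Ext

end Gorenstein

end RelGor

/-! ### The main theorem. -/

open RelGor in
theorem theorem3p11 {A : Type u} [Category.{v} A] [Abelian A]
    [EnoughProjectives A] [EnoughInjectives A]
    [HasCoproducts.{v} A] [AB4 A] [HasProducts.{v} A] [AB4Star A] [HasExt.{w} A]
    (C D : ObjectProperty A)
    [C.IsClosedUnderFiniteProducts] [C.IsStableUnderRetracts] [D.IsClosedUnderIsomorphisms]
    (hC : C ≤ D ⊓ leftPerp.{w} D) (hP : isProjective A ≤ rG.{w} C D) (n : ℕ) :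
    List.TFAE [
      IsRightGorenstein C D n,
      ∀ M : A, relPd (rG.{w} C D) M ≤ n,
      relPdSup (rG.{w} C D) (isInjective A) ≤ n ∧ injDimSup D ≤ n] ∧
    ((relPdLE D n = injDimLE A n ∧ injDimLE A n = relPdLE C n) → IsRightGorenstein C D n) ∧
    ((relPdLE D n ≤ injDimLE A n ∧ injDimLE A n ≤ relPdLE (rG.{w} C D) n) →
      (relPdSup (rG.{w} C D) (isInjective A) ≤ n ∧ injDimSup D ≤ n)) ∧
    (ClosedUnderKernelsOfEpis C → List.TFAE [
      IsRightGorenstein C D n,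
      ∀ M : A, relPd (rG.{w} C D) M ≤ n,
      relPdSup (rG.{w} C D) (isInjective A) ≤ n ∧ injDimSup D ≤ n,
      relPdLE D n = injDimLE A n ∧ injDimLE A n = relPdLE C n]) ∧
    (IsPrecovering (rG.{w} C D) ∧ IsResolving (rG.{w} C D) → List.TFAE [
      IsRightGorenstein C D n,
      ∀ M : A, relPd (rG.{w} C D) M ≤ n,
      relPdSup (rG.{w} C D) (isInjective A) ≤ n ∧ injDimSup D ≤ n,
      relPdLE D n ≤ injDimLE A n ∧ injDimLE A n ≤ relPdLE (rG.{w} C D) n]) := by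
  have hC' : C ≤ leftPerp.{w} D := fun M hM => (hC M hM).2
  have hCD : C ≤ D := fun M hM => (hC M hM).1
  have hG : C ≤ rG.{w} C D := rG_of_prop hC'
  have hGD : rG.{w} C D ≤ leftPerp.{w} D := fun M hM => hM.1
  have : (rG.{w} C D).IsClosedUnderIsomorphisms := ⟨fun e h => rG_of_iso hC' e h⟩
  have : C.IsClosedUnderIsomorphisms := inferInstance
  have hC0 := prop_zero_of_isClosedUnderFiniteProducts C
  have hpdC := fun M => relPd_le_iff hC0 M n
  have hpdD := fun M => relPd_le_iff (hCD _ hC0) M n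
  have hpdG := fun M => relPd_le_iff (hG _ hC0) M n
  have hid := fun M : A => injDim_le_iff M n
  have hInj : ∀ I : A, Injective I → injDim I ≤ n := fun I _ =>
    (hid I).2 (hasInjectiveDimensionLT_of_ge _ 1 _ (by lia))
  have hDD : ∀ Y, D Y → relPd D Y ≤ n := fun Y hY =>
    (hpdD Y).2 (PdLE.of_le (hCD _ hC0) (Nat.zero_le n) hY)
  have h12 : IsRightGorenstein C D n → ∀ M : A, relPd (rG.{w} C D) M ≤ n := by
    intro h M
    simp only [IsRightGorenstein, relPdSup, injDimSup, iSup₂_le_iff, hpdC, hid] at h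
    -- A `C`-resolution of an injective is in particular a resolution by `rG C D`.
    exact (hpdG M).2 (pdLE_rG_of_injective hC hP (fun I hI => (h.1 I hI).mono hG) h.2 M)
  have h23 : (∀ M : A, relPd (rG.{w} C D) M ≤ n) →
      relPdSup (rG.{w} C D) (isInjective A) ≤ n ∧ injDimSup D ≤ n := fun h =>
    ⟨iSup₂_le fun M _ => h M, iSup₂_le fun Y hY => (hid Y).2
      (hasInjectiveDimensionLT_of_forall_pdLE hGD (fun M => (hpdG M).1 (h M)) Y hY)⟩
  have h31 : relPdSup (rG.{w} C D) (isInjective A) ≤ n ∧ injDimSup D ≤ n →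
      IsRightGorenstein C D n := fun h =>
    ⟨iSup₂_le fun I hI => (hpdC I).2 (have : Injective I := hI
      pdLE_of_injective_of_pdLE_rG hC ((hpdG I).1 (iSup₂_le_iff.1 h.1 I hI))), h.2⟩
  have h41 : relPdLE D n = injDimLE A n ∧ injDimLE A n = relPdLE C n →
      IsRightGorenstein C D n := fun h =>
    ⟨iSup₂_le fun I hI => h.2.le I (hInj I hI), iSup₂_le fun Y hY => h.1.le Y (hDD Y hY)⟩
  have h53 : relPdLE D n ≤ injDimLE A n ∧ injDimLE A n ≤ relPdLE (rG.{w} C D) n →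
      relPdSup (rG.{w} C D) (isInjective A) ≤ n ∧ injDimSup D ≤ n := fun h =>
    ⟨iSup₂_le fun I hI => h.2 I (hInj I hI), iSup₂_le fun Y hY => h.1 Y (hDD Y hY)⟩
  have hDid : injDimSup D ≤ n → relPdLE D n ≤ injDimLE A n := fun h M hM =>
    (hid M).2 (HasInjectiveDimensionLT.of_pdLE
      (fun Y hY => (hid Y).1 (iSup₂_le_iff.1 h Y hY)) ((hpdD M).1 hM))
  refine ⟨?_, h41, h53, fun hk => ?_, fun _ => ?_⟩
  · tfae_have 1 → 2 := h12
    tfae_have 2 → 3 := h23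
    tfae_have 3 → 1 := h31
    tfae_finish
  · tfae_have 1 → 2 := h12
    tfae_have 2 → 3 := h23
    tfae_have 3 → 1 := h31
    tfae_have 4 → 1 := h41
    -- The equalities come from a cycle of inclusions: `C`-dimension at most `n` implies
    -- `D`-dimension at most `n`, then injective dimension at most `n`, then `C`-dimension at most
    -- `n`.
    tfae_have 1 → 4 := by
      intro h
      have hCd : relPdLE C n ≤ relPdLE D n := fun M hM =>
        (hpdD M).2 (((hpdC M).1 hM).mono hCD)
      have hidC : injDimLE A n ≤ relPdLE C n := fun M hM =>
        (hpdC M).2 (pdLE_of_hasInjectiveDimensionLT hC hk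
          (fun I hI => (hpdC I).1 (iSup₂_le_iff.1 h.1 I hI)) ((hid M).1 hM))
      exact ⟨le_antisymm (hDid h.2) (hidC.trans hCd), le_antisymm hidC (hCd.trans (hDid h.2))⟩
    tfae_finish
  · tfae_have 1 → 2 := h12
    tfae_have 2 → 3 := h23
    tfae_have 3 → 1 := h31
    tfae_have 4 → 3 := h53
    tfae_have 2 → 4 := fun h => ⟨hDid (h23 h).2, fun M _ => h M⟩
    tfae_finish
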